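/- Let $d\ge 0$ and let $A=(a_1,\dots,a_n)$ be a finite configuration of points of $\mathbb{R}^d$, possibly repeated or affinely dependent, whose affine span is $\mathbb{R}^d$. Put $v_i=(a_i,1)\in\mathbb{R}^{d+1}$ and let $Z(V)=\sum_{i=1}^n[0,v_i]$ be the associated zonotope (Minkowski sum). For disjoint $I,B\subseteq[n]$ let $\Pi_{I,B}=\sum_{i\in I}v_i+\sum_{b\in B}[0,v_b]$. The faces of $\Pi_{I,B}$ are the $\Pi_{J,C}$ with $C\subseteq B$ and $I\subseteq J\subseteq I\cup(B\setminus C)$. A fine zonotopal tiling of $Z(V)$ is a set $\mathcal{P}$ of tiles $\Pi_{I,B}$, labelled by pairs $(I,B)$ with $I\cap B=\varnothing$, $|B|=d+1$ and $(a_b)_{b\in B}$ affinely independent, whose union is $Z(V)$ and such that any two of them are disjoint or intersect in a common face $\Pi_{J,C}$ of both. The order of $\Pi_{I,B}$ is $|I|$, and $\mathcal{P}^{(k)}$ is the set of tiles of order $k$. Let $$\mathrm{ch}_k(A)=\bigcap_{S\subseteq[n],\,|S|=n-k}\mathrm{ch}(\{a_i\}_{i\in S}),$$ where $\mathrm{ch}$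 denotes the convex hull. Let $\mathcal{P}$ be any fine zonotopal tiling of $Z(V)$ and let $0\le k\le n-d-1$. Then the simplices $\Delta_B=\mathrm{ch}(\{a_b\}_{b\in B})$, one for each tile $\Pi_{I,B}\in\mathcal{P}^{(k)}$ (counted with multiplicity), cover $\mathrm{ch}_k(A)$ exactly $\binom{k+d}{d}$ times, in the following sense. 1. For Lebesgue-almost every $x\in\mathrm{ch}_k(A)$, exactly $\binom{k+d}{d}$ tiles $\Pi_{I,B}\in\mathcal{P}^{(k)}$ satisfy $x\in\Delta_B$. 2. If $\mathrm{ch}_k(A)$ has nonempty interior, then for every $x\in\mathrm{ch}_k(A)$ at least $\binom{k+d}{d}$ tiles of $\mathcal{P}^{(k)}$ satisfy $x\in\Delta_B$ and at most $\binom{k+d}{d}$ of them have $x$ in the interior of $\Delta_B$; and exactly $\binom{k+d}{d}$ tiles satisfy $x\in\Delta_B$ whenever $x$ lies on the boundary of none of the simplices $\Delta_B$, $\Pi_{I,B}\in\mathcal{P}^{(k)}$. -/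

import Mathlib

open scoped Pointwise

noncomputable section

namespace ZonoTiling

/-- A label `(I, B)`: a pair of sets of indices from `[n]`. -/
abbrev Label (n : ℕ) := Finset (Fin n) × Finset (Fin n)

variable {d n : ℕ}

/-- The projective lift `(x, 1)` of a point `x` of `ℝ^d`, in `ℝ^d × ℝ = ℝ^(d+1)`. -/
def lift (x : EuclideanSpace ℝ (Fin d)) : EuclideanSpace ℝ (Fin d) × ℝ := (x, 1)

/-- The zonotope `Z(V) = ∑ i, [0, v_i]` (a Minkowski sum), where `v_i = (a_i, 1)`. -/
def zonotope (a : Fin n → EuclideanSpace ℝ (Fin d)) : Set (EuclideanSpace ℝ (Fin d) × ℝ) :=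
  ∑ i, segment ℝ 0 (lift (a i))

/-- The parallelepiped `Π_{I,B} = ∑_{i ∈ I} v_i + ∑_{b ∈ B} [0, v_b]` of a label `(I, B)`. -/
def tileSet (a : Fin n → EuclideanSpace ℝ (Fin d)) (T : Label n) :
    Set (EuclideanSpace ℝ (Fin d) × ℝ) :=
  {∑ i ∈ T.1, lift (a i)} + ∑ b ∈ T.2, segment ℝ 0 (lift (a b))

/-- `(I, B)` labels a full-dimensional tile: `I` and `B` are disjoint, `B` has `d + 1` elements,
and the points `a_b`, `b ∈ B`, are affinely independent. -/
structure IsTileLabel (a : Fin n → EuclideanSpace ℝ (Fin d)) (T : Label n) : Prop where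
  disjoint : Disjoint T.1 T.2
  card_eq : T.2.card = d + 1
  affineIndependent : AffineIndependent ℝ (fun b : T.2 => a b)

/-- `Π_{J,C}` is the face of `Π_{I,B}` obtained by fixing the coefficients of the segments
`[0, v_b]`, `b ∈ B \ C`, to `0` or `1`; here `J` is `I` together with the indices whose
coefficient is fixed to `1`. -/
def IsFace (F T : Label n) : Prop :=
  F.2 ⊆ T.2 ∧ T.1 ⊆ F.1 ∧ F.1 ⊆ T.1 ∪ (T.2 \ F.2)

/-- A fine zonotopal tiling of `Z(V)`: a collection of parallelepipeds `Π_{I,B}` that forms a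
polyhedral subdivision of `Z(V)`, i.e. their union is `Z(V)` and any two of them meet in a
(possibly empty) common face `Π_{J,C}`. -/
structure IsFineZonotopalTiling (a : Fin n → EuclideanSpace ℝ (Fin d)) (P : Set (Label n)) :
    Prop where
  isTileLabel : ∀ T ∈ P, IsTileLabel a T
  iUnion_eq : ⋃ T ∈ P, tileSet a T = zonotope a
  inter_face : ∀ T ∈ P, ∀ T' ∈ P, (tileSet a T ∩ tileSet a T').Nonempty →
    ∃ F : Label n, IsFace F T ∧ IsFace F T' ∧
      tileSet a T ∩ tileSet a T' = tileSet a F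

/-- The tiles of order `k`: those `Π_{I,B}` of the tiling for which `I` has `k` elements. -/
def orderTiles (P : Set (Label n)) (k : ℕ) : Set (Label n) := {T ∈ P | T.1.card = k}

/-- The simplex `ch({a_b}_{b ∈ B})` of the tile labelled `(I, B)`. -/
def simplex (a : Fin n → EuclideanSpace ℝ (Fin d)) (T : Label n) :
    Set (EuclideanSpace ℝ (Fin d)) :=
  convexHull ℝ (a '' (T.2 : Set (Fin n)))

/-- `ch_k(A)`: the intersection of the convex hulls of all subconfigurations of size `n - k`. -/
def chk (a : Fin n → EuclideanSpace ℝ (Fin d)) (k : ℕ) : Set (EuclideanSpace ℝ (Fin d)) :=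
  ⋂ S : Finset (Fin n), ⋂ _ : S.card = n - k, convexHull ℝ (a '' (S : Set (Fin n)))

/-- The number of tiles of order `k` whose simplex contains `x`. -/
def coverCount (a : Fin n → EuclideanSpace ℝ (Fin d)) (P : Set (Label n)) (k : ℕ)
    (x : EuclideanSpace ℝ (Fin d)) : ℕ :=
  {T ∈ orderTiles P k | x ∈ simplex a T}.ncard

/-- The number of tiles of order `k` whose simplex contains `x` in its interior. -/
def interiorCoverCount (a : Fin n → EuclideanSpace ℝ (Fin d)) (P : Set (Label n)) (k : ℕ)
    (x : EuclideanSpace ℝ (Fin d)) : ℕ :=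
  {T ∈ orderTiles P k | x ∈ interior (simplex a T)}.ncard

end ZonoTiling

end

noncomputable section
namespace ZonoTiling

open Set

/-! Write `L` for the map sending a coefficient vector in the cube to the corresponding combination
of the `v_i`. Each tile is the image of a box, a face of the cube. A tiling is a section: `L` maps
the union of its boxes bijectively onto the zonotope (`IsFineZonotopalTiling.isSection`). Sections
survive deletion of an index `e` (`IsSection.erase`), because along direction `v_e` the lifted
`e`-th coefficient grows at most at unit speed, and at unit speed nothing else moves
(`IsSection.coeff_le`).

Delete a set `K` and let `x` be a generic point of the hull of the remaining `a_i`. The point `(x,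
1) / 2` has a unique lift, with coefficient sum 1/2. No coefficient is then 1, so the tile has `I ⊆
K`, and genericity forces `B ∩ K = ∅`. Hence `x` lies in the simplex of exactly one tile with `I ⊆
K` and `B ∩ K = ∅` (`IsFineZonotopalTiling.existsUnique_tile`).

If `x ∈ ch_k(A)`, this applies to every `K` of size `j ≤ k`. Let `N_i` be the number of order-`i`
tiles whose simplex contains `x`. Counting pairs (K, tile) gives `C(n,j) = ∑_{i≤j} N_i C(n-d-1-i,
j-i)`, a triangular system solved by `N_i = C(i+d,d)`. Non-generic points are reached by
approximation. -/

/-- If finitely many closed sets cover `[a, b]` and a transitive relation holds between any two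
points `x ≤ y` of the same set, then it holds between `a` and `b`. -/
theorem rel_of_finite_closed_cover {α : Type*} [DecidableEq α] {R : ℝ → ℝ → Prop}
    (htrans : ∀ x y z, R x y → R y z → R x z) {F : α → Set ℝ} (hF : ∀ i, IsClosed (F i))
    (s : Finset α) {a b : ℝ} (hab : a ≤ b) (hcov : Icc a b ⊆ ⋃ i ∈ s, F i)
    (hR : ∀ i ∈ s, ∀ x ∈ F i, ∀ y ∈ F i, a ≤ x → x ≤ y → y ≤ b → R x y) : R a b := by
  induction s using Finset.strongInduction generalizing a with
  | H s ih =>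
    obtain ⟨i, hi, hai⟩ := mem_iUnion₂.1 (hcov (left_mem_Icc.2 hab))
    obtain ⟨c, ⟨hci, hac, hcb⟩, hmax⟩ := (isCompact_Icc.inter_left (hF i)).exists_isGreatest
      ⟨a, hai, left_mem_Icc.2 hab⟩
    have hRac : R a c := hR i hi a hai c hci le_rfl hac hcb
    rcases hcb.eq_or_lt with rfl | hlt
    · exact hRac
    refine htrans a c b hRac (ih (s.erase i) (Finset.erase_ssubset hi) hcb ?_ ?_)
    -- The set `F i` has no point in `(c, b]`, so the other sets cover it. Their union is closed, so
    -- it also contains `c`.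
    · have hcl : IsClosed (⋃ j ∈ s.erase i, F j) :=
        (s.erase i).finite_toSet.isClosed_biUnion fun j _ => hF j
      rw [← closure_Ioc hlt.ne]
      refine closure_minimal (fun x hx => ?_) hcl
      obtain ⟨j, hj, hxj⟩ := mem_iUnion₂.1 (hcov ⟨hac.trans hx.1.le, hx.2⟩)
      refine mem_iUnion₂.2 ⟨j, Finset.mem_erase.2 ⟨?_, hj⟩, hxj⟩
      rintro rfl
      exact absurd (hmax ⟨hxj, hac.trans hx.1.le, hx.2⟩) (not_le.2 hx.1)
    · intro j hj x hx y hy hcx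
      exact hR j (Finset.mem_of_mem_erase hj) x hx y hy (hac.trans hcx)

/-! ### Sections over a zonotope and their deletions -/

section Section

set_option linter.unusedSectionVars false

variable {ι : Type*} [Fintype ι] [DecidableEq ι]
  {E : Type*} [NormedAddCommGroup E] [NormedSpace ℝ E]

/-- The coefficient vectors of the points of the parallelepiped with label `(I, B)`. -/
def box (T : Finset ι × Finset ι) : Set (ι → ℝ) :=
  {l | (∀ i ∈ T.1, l i = 1) ∧ (∀ i ∈ T.2, l i ∈ Icc (0 : ℝ) 1) ∧ ∀ i, i ∉ T.1 → i ∉ T.2 → l i = 0}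

theorem box_mem_Icc {T : Finset ι × Finset ι} {l : ι → ℝ} (hl : l ∈ box T) (i : ι) :
    l i ∈ Icc (0 : ℝ) 1 := by
  by_cases h1 : i ∈ T.1
  · simp [hl.1 i h1]
  by_cases h2 : i ∈ T.2
  · exact hl.2.1 i h2
  · simp [hl.2.2 i h1 h2]

theorem isCompact_box (T : Finset ι × Finset ι) : IsCompact (box T) := by
  refine (isCompact_univ_pi (fun _ : ι => isCompact_Icc (a := (0 : ℝ)) (b := 1))).of_isClosed_subset
    ?_ fun l hl i _ => box_mem_Icc hl i
  simp only [box, ofPred_and, ofPred_forall]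
  refine IsClosed.inter ?_ (IsClosed.inter ?_ ?_)
  · exact isClosed_iInter fun i => isClosed_iInter fun _ =>
      isClosed_eq (continuous_apply i) continuous_const
  · exact isClosed_iInter fun i => isClosed_iInter fun _ =>
      isClosed_Icc.preimage (continuous_apply i)
  · exact isClosed_iInter fun i => isClosed_iInter fun _ => isClosed_iInter fun _ =>
      isClosed_eq (continuous_apply i) continuous_const

theorem convex_box (T : Finset ι × Finset ι) : Convex ℝ (box T) := by
  intro l hl m hm p q hp hq hpq
  refine ⟨fun i hi => ?_, fun i hi => ?_, fun i h1 h2 => ?_⟩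
  · simp [hl.1 i hi, hm.1 i hi, hpq]
  · exact convex_Icc (0 : ℝ) 1 (hl.2.1 i hi) (hm.2.1 i hi) hp hq hpq
  · simp [hl.2.2 i h1 h2, hm.2.2 i h1 h2]

/-- The boxes of the labels in `Q` form the image of a section, over the zonotope of `(v_i)_{i ∈ S}`,
of the map sending a coefficient vector to the corresponding combination of the `v_i`. -/
structure IsSection (v : ι → E) (S : Finset ι) (Q : Set (Finset ι × Finset ι)) : Prop where
  disjoint : ∀ T ∈ Q, Disjoint T.1 T.2
  indep : ∀ T ∈ Q, LinearIndepOn ℝ v (T.2 : Set ι)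
  fst_subset : ∀ T ∈ Q, T.1 ⊆ S
  snd_subset : ∀ T ∈ Q, T.2 ⊆ S
  inj : InjOn (Fintype.linearCombination ℝ v) (⋃ T ∈ Q, box T)
  surj : Fintype.linearCombination ℝ v '' box (∅, S) ⊆
    Fintype.linearCombination ℝ v '' ⋃ T ∈ Q, box T

theorem continuous_linearCombination (v : ι → E) :
    Continuous (Fintype.linearCombination ℝ v) :=
  LinearMap.continuous_on_pi _

theorem linearCombination_single (v : ι → E) (e : ι) (c : ℝ) :
    Fintype.linearCombination ℝ v (Pi.single e c) = c • v e := by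
  simp [Fintype.linearCombination_apply_single]

theorem linearCombination_eq_sum (v : ι → E) {B : Finset ι} {l : ι → ℝ}
    (hl : ∀ i ∉ B, l i = 0) : Fintype.linearCombination ℝ v l = ∑ i ∈ B, l i • v i := by
  rw [Fintype.linearCombination_apply]
  exact (Finset.sum_subset (Finset.subset_univ B) fun i _ hi => by simp [hl i hi]).symm

theorem eq_zero_of_linearCombination_eq_zero {v : ι → E} {B : Finset ι}
    (hB : LinearIndepOn ℝ v (B : Set ι)) {l : ι → ℝ} (hl : ∀ i ∉ B, l i = 0)
    (h : Fintype.linearCombination ℝ v l = 0) : l = 0 := by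
  rw [linearCombination_eq_sum v hl] at h
  ext i
  by_cases hi : i ∈ B
  · exact linearIndepOn_finset_iff.1 hB l h i hi
  · exact hl i hi

theorem injOn_box {v : ι → E} {T : Finset ι × Finset ι}
    (hB : LinearIndepOn ℝ v (T.2 : Set ι)) : InjOn (Fintype.linearCombination ℝ v) (box T) := by
  intro l hl m hm h
  refine sub_eq_zero.1 (eq_zero_of_linearCombination_eq_zero hB (fun i hi => ?_) ?_)
  · by_cases h1 : i ∈ T.1
    · simp [hl.1 i h1, hm.1 i h1]
    · simp [hl.2.2 i h1 hi, hm.2.2 i h1 hi]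
  · rw [map_sub, h, sub_self]

variable {v : ι → E} {S : Finset ι} {Q : Set (Finset ι × Finset ι)}

theorem IsSection.box_subset (h : IsSection v S Q) {T : Finset ι × Finset ι} (hT : T ∈ Q) :
    box T ⊆ box (∅, S) := by
  intro l hl
  exact ⟨by simp, fun i _ => box_mem_Icc hl i, fun i _ hi =>
    hl.2.2 i (fun h1 => hi (h.fst_subset T hT h1)) fun h2 => hi (h.snd_subset T hT h2)⟩

/-- Along a line of direction `v_e` the `e`-th coefficient grows at most at unit speed, and where
it grows at unit speed the other coefficients do not change. -/
theorem IsSection.coeff_le (h : IsSection v S Q) {e : ι} {l m : ι → ℝ}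
    (hl : l ∈ ⋃ T ∈ Q, box T) (hm : m ∈ ⋃ T ∈ Q, box T) {t : ℝ} (ht : 0 ≤ t)
    (hlm : Fintype.linearCombination ℝ v m = Fintype.linearCombination ℝ v l + t • v e) :
    m e - l e ≤ t ∧ (m e - l e = t → ∀ i, i ≠ e → m i = l i) := by
  classical
  set L := Fintype.linearCombination ℝ v with hL
  have hconv : Convex ℝ (L '' box (∅, S)) := (convex_box _).linear_image L
  have hsub : (⋃ T ∈ Q, box T) ⊆ box (∅, S) := iUnion₂_subset fun T hT => h.box_subset hT
  -- The zonotope is convex, so the whole segment from `L l` to `L m` lifts to the section.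
  have hγ : ∀ s ∈ Icc 0 t, ∃ g ∈ ⋃ T ∈ Q, box T, L g = L l + s • v e := by
    intro s hs
    refine h.surj ?_
    rcases ht.eq_or_lt with rfl | htpos
    · obtain rfl : s = 0 := le_antisymm hs.2 hs.1
      exact ⟨l, hsub hl, by simp [hL]⟩
    · have := hconv ⟨l, hsub hl, rfl⟩ ⟨m, hsub hm, rfl⟩ (a := 1 - s / t) (b := s / t)
        (sub_nonneg.2 (div_le_one_of_le₀ hs.2 ht)) (div_nonneg hs.1 ht) (by ring)
      rw [hlm, smul_add, smul_smul, div_mul_cancel₀ _ htpos.ne', ← add_assoc, ← add_smul,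
        sub_add_cancel, one_smul] at this
      exact this
  choose! γ hγmem hγL using hγ
  have h0 : γ 0 = l := h.inj (hγmem 0 ⟨le_rfl, ht⟩) hl (by
    have := hγL 0 ⟨le_rfl, ht⟩
    simpa using this)
  have h1 : γ t = m := h.inj (hγmem t ⟨ht, le_rfl⟩) hm (by
    have := hγL t ⟨ht, le_rfl⟩
    rw [← hL, this, hlm])
  -- The desired relation is transitive along the segment, so it suffices to check it between two
  -- points of the same tile.
  have key := rel_of_finite_closed_cover
    (R := fun x y => γ y e - γ x e ≤ y - x ∧ (γ y e - γ x e = y - x → ∀ i, i ≠ e → γ y i = γ x i))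
    ?_ (F := fun T : Finset ι × Finset ι => (fun s : ℝ => L l + s • v e) ⁻¹' (L '' box T)) ?_
    Q.toFinite.toFinset ht ?_ ?_
  · simpa [h0, h1] using key
  · rintro x y z ⟨hxy, hxy'⟩ ⟨hyz, hyz'⟩
    refine ⟨by linarith, fun heq i hi => ?_⟩
    rw [hyz' (by linarith) i hi, hxy' (by linarith) i hi]
  · intro T
    exact ((isCompact_box T).image (continuous_linearCombination v)).isClosed.preimage
      (by fun_prop)
  · intro s hs
    obtain ⟨T, hT, hsT⟩ := mem_iUnion₂.1 (hγmem s hs)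
    exact mem_iUnion₂.2 ⟨T, by simpa using hT, γ s, hsT, hγL s hs⟩
  · intro T hT x hx y hy h0x hxy hyt
    replace hT : T ∈ Q := by simpa using hT
    have hmem : ∀ s ∈ Icc 0 t, L l + s • v e ∈ L '' box T → γ s ∈ box T := by
      rintro s hs ⟨g, hg, hgL⟩
      rwa [h.inj (hγmem s hs) (mem_iUnion₂.2 ⟨T, hT, hg⟩) ((hγL s hs).trans hgL.symm)]
    have hxI : x ∈ Icc 0 t := ⟨h0x, hxy.trans hyt⟩
    have hyI : y ∈ Icc 0 t := ⟨h0x.trans hxy, hyt⟩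
    have hγx := hmem x hxI hx
    have hγy := hmem y hyI hy
    -- If `e ∈ B`, independence makes the lift move exactly along coordinate `e`, at unit speed.
    -- Otherwise the `e`-th coefficient is constant on the box, and unit growth is possible only
    -- when `y = x`.
    by_cases he : e ∈ T.2
    · have hz : γ y - γ x - Pi.single e (y - x) = 0 := by
        refine eq_zero_of_linearCombination_eq_zero (h.indep T hT) (fun i hi => ?_) ?_
        · have hie : i ≠ e := fun hie => hi (hie ▸ he)
          by_cases h1 : i ∈ T.1
          · simp [hγx.1 i h1, hγy.1 i h1, hie]
          · simp [hγx.2.2 i h1 hi, hγy.2.2 i h1 hi, hie]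
        · rw [map_sub, map_sub, linearCombination_single, ← hL, hγL x hxI, hγL y hyI]
          module
      have hz' : ∀ i, γ y i - γ x i - (Pi.single e (y - x) : ι → ℝ) i = 0 := fun i => congrFun hz i
      refine ⟨?_, fun _ i hi => ?_⟩
      · have := hz' e
        rw [Pi.single_eq_same] at this
        linarith
      · have := hz' i
        rw [Pi.single_eq_of_ne hi] at this
        linarith
    · have hee : γ y e = γ x e := by
        by_cases h1 : e ∈ T.1
        · rw [hγx.1 e h1, hγy.1 e h1]
        · rw [hγx.2.2 e h1 he, hγy.2.2 e h1 he]
      refine ⟨by linarith, fun heq i _ => ?_⟩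
      obtain rfl : y = x := by linarith
      rfl

/-- Remove an index from a label. -/
def eraseLabel (e : ι) (T : Finset ι × Finset ι) : Finset ι × Finset ι :=
  (T.1.erase e, T.2.erase e)

theorem update_mem_box_eraseLabel {e : ι} {T : Finset ι × Finset ι} {l : ι → ℝ}
    (hl : l ∈ box T) : Function.update l e 0 ∈ box (eraseLabel e T) := by
  refine ⟨fun i hi => ?_, fun i hi => ?_, fun i h1 h2 => ?_⟩
  · obtain ⟨hie, hi⟩ := Finset.mem_erase.1 hi
    rw [Function.update_of_ne hie, hl.1 i hi]
  · obtain ⟨hie, hi⟩ := Finset.mem_erase.1 hi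
    rw [Function.update_of_ne hie]
    exact hl.2.1 i hi
  · by_cases hie : i = e
    · subst hie; simp
    · rw [Function.update_of_ne hie]
      exact hl.2.2 i (fun h => h1 (Finset.mem_erase.2 ⟨hie, h⟩))
        fun h => h2 (Finset.mem_erase.2 ⟨hie, h⟩)

/-- The erased coefficient is restored as 1 if `e ∈ I`, and as 0 otherwise, which is allowed whether
or not `e ∈ B`. -/
theorem exists_update_of_mem_box_eraseLabel {e : ι} {T : Finset ι × Finset ι}
    (hT : Disjoint T.1 T.2) {l : ι → ℝ} (hl : l ∈ box (eraseLabel e T)) :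
    ∃ m ∈ box T, Function.update m e 0 = l := by
  have hle : l e = 0 := hl.2.2 e (by simp [eraseLabel]) (by simp [eraseLabel])
  by_cases he : e ∈ T.1
  · refine ⟨Function.update l e 1, ⟨fun i hi => ?_, fun i hi => ?_, fun i h1 h2 => ?_⟩, ?_⟩
    · by_cases hie : i = e
      · subst hie; simp
      · rw [Function.update_of_ne hie]
        exact hl.1 i (Finset.mem_erase.2 ⟨hie, hi⟩)
    · have hie : i ≠ e := fun hie => Finset.disjoint_left.1 hT he (hie ▸ hi)
      rw [Function.update_of_ne hie]
      exact hl.2.1 i (Finset.mem_erase.2 ⟨hie, hi⟩)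
    · have hie : i ≠ e := fun hie => h1 (hie ▸ he)
      rw [Function.update_of_ne hie]
      exact hl.2.2 i (fun h => h1 (Finset.mem_of_mem_erase h))
        fun h => h2 (Finset.mem_of_mem_erase h)
    · simp [← hle]
  · refine ⟨l, ⟨fun i hi => ?_, fun i _ => box_mem_Icc hl i, fun i h1 h2 => ?_⟩, ?_⟩
    · exact hl.1 i (Finset.mem_erase.2 ⟨fun hie => he (hie ▸ hi), hi⟩)
    · exact hl.2.2 i (fun h => h1 (Finset.mem_of_mem_erase h))
        fun h => h2 (Finset.mem_of_mem_erase h)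
    · simp [← hle]

theorem linearCombination_update_zero (v : ι → E) (e : ι) (l : ι → ℝ) :
    Fintype.linearCombination ℝ v (Function.update l e 0) =
      Fintype.linearCombination ℝ v l - l e • v e := by
  rw [← linearCombination_single, ← map_sub]
  congr 1
  ext i
  by_cases hie : i = e
  · subst hie; simp
  · simp [hie]

/-- Some translate of a point along `v_e` has as `e`-th coefficient the length of the
translation. -/
theorem IsSection.exists_coeff_eq (h : IsSection v S Q) {e : ι} (he : e ∈ S) {m : ι → ℝ}
    (hm : m ∈ box (∅, S.erase e)) :
    ∃ l ∈ ⋃ T ∈ Q, box T, Fintype.linearCombination ℝ v l =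
      Fintype.linearCombination ℝ v m + l e • v e := by
  set L := Fintype.linearCombination ℝ v with hL
  set Λ := ⋃ T ∈ Q, box T with hΛ
  have hΛc : IsCompact Λ := Q.toFinite.isCompact_biUnion fun T _ => isCompact_box T
  have hLc : Continuous L := continuous_linearCombination v
  have hex : ∀ t ∈ Icc (0 : ℝ) 1, ∃ l ∈ Λ, L l = L m + t • v e := by
    intro t ht
    refine h.surj ⟨m + Pi.single e t, ⟨by simp, fun i hi => ?_, fun i _ hi => ?_⟩, ?_⟩
    · by_cases hie : i = e
      · subst hie
        have : m i = 0 := hm.2.2 i (by simp) (by simp)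
        simpa [this] using ht
      · simpa [hie] using box_mem_Icc hm i
    · have hie : i ≠ e := fun hie => hi (hie ▸ he)
      have : m i = 0 := hm.2.2 i (by simp) fun hi' => hi (Finset.mem_of_mem_erase hi')
      simp [this, hie]
    · rw [map_add, linearCombination_single]
  -- Projections of compact sets are closed. This allows an intermediate value argument on the lift
  -- of `L m + t • v e` without proving the lift continuous in `t`.
  have hclosed : ∀ C : Set (ℝ × ℝ), IsClosed C →
      IsClosed (Prod.fst '' ((Icc (0 : ℝ) 1 ×ˢ Λ) ∩
        {q : ℝ × (ι → ℝ) | L q.2 = L m + q.1 • v e ∧ (q.2 e, q.1) ∈ C})) := by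
    intro C hC
    refine (((isCompact_Icc.prod hΛc).inter_right ?_).image continuous_fst).isClosed
    exact (isClosed_eq (by fun_prop) (by fun_prop)).inter (hC.preimage (by fun_prop))
  obtain ⟨t, ht, ⟨⟨t₁, l₁⟩, ⟨⟨_, hl₁⟩, hLl₁, hle₁⟩, rfl⟩, ⟨⟨t₂, l₂⟩, ⟨⟨_, hl₂⟩, hLl₂, hle₂⟩, ht₂⟩⟩ :=
    isPreconnected_closed_iff.1 (isPreconnected_Icc (a := (0 : ℝ)) (b := 1)) _ _
      (hclosed {p | p.1 ≤ p.2} (isClosed_le continuous_fst continuous_snd))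
      (hclosed {p | p.2 ≤ p.1} (isClosed_le continuous_snd continuous_fst))
      (by
        intro t ht
        obtain ⟨l, hl, hLl⟩ := hex t ht
        rcases le_total (l e) t with hle | hle
        · exact Or.inl ⟨(t, l), ⟨⟨ht, hl⟩, hLl, hle⟩, rfl⟩
        · exact Or.inr ⟨(t, l), ⟨⟨ht, hl⟩, hLl, hle⟩, rfl⟩)
      (by
        have h1 : (1 : ℝ) ∈ Icc (0 : ℝ) 1 := by simp
        obtain ⟨l, hl, hLl⟩ := hex 1 h1
        obtain ⟨T, _, hlT⟩ := mem_iUnion₂.1 hl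
        exact ⟨1, h1, (1, l), ⟨⟨h1, hl⟩, hLl, (box_mem_Icc hlT e).2⟩, rfl⟩)
      (by
        have h0 : (0 : ℝ) ∈ Icc (0 : ℝ) 1 := by simp
        obtain ⟨l, hl, hLl⟩ := hex 0 h0
        obtain ⟨T, _, hlT⟩ := mem_iUnion₂.1 hl
        exact ⟨0, h0, (0, l), ⟨⟨h0, hl⟩, hLl, (box_mem_Icc hlT e).1⟩, rfl⟩)
  simp only at hLl₁ hle₁ hLl₂ hle₂ ht₂ ht hl₁ hl₂
  subst ht₂
  obtain rfl : l₂ = l₁ := h.inj hl₂ hl₁ (hLl₂.trans hLl₁.symm)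
  refine ⟨l₂, hl₁, ?_⟩
  have hle : l₂ e = t₂ := le_antisymm hle₁ hle₂
  rw [hLl₁, hle]

/-- Deleting an index from all the labels of a section gives a section. -/
theorem IsSection.erase (h : IsSection v S Q) {e : ι} (he : e ∈ S) :
    IsSection v (S.erase e) (eraseLabel e '' Q) where
  disjoint := by
    rintro _ ⟨T, hT, rfl⟩
    exact (h.disjoint T hT).mono (Finset.erase_subset _ _) (Finset.erase_subset _ _)
  indep := by
    rintro _ ⟨T, hT, rfl⟩
    exact (h.indep T hT).mono (Finset.coe_subset.2 (Finset.erase_subset _ _))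
  fst_subset := by
    rintro _ ⟨T, hT, rfl⟩
    exact Finset.erase_subset_erase e (h.fst_subset T hT)
  snd_subset := by
    rintro _ ⟨T, hT, rfl⟩
    exact Finset.erase_subset_erase e (h.snd_subset T hT)
  inj := by
    intro l' hl' m' hm' hlm
    simp only [biUnion_image, mem_iUnion₂] at hl' hm'
    obtain ⟨T, hT, hl'⟩ := hl'
    obtain ⟨T', hT', hm'⟩ := hm'
    obtain ⟨l, hl, rfl⟩ := exists_update_of_mem_box_eraseLabel (h.disjoint T hT) hl'
    obtain ⟨m, hm, rfl⟩ := exists_update_of_mem_box_eraseLabel (h.disjoint T' hT') hm'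
    replace hl : l ∈ ⋃ T ∈ Q, box T := mem_iUnion₂.2 ⟨T, hT, hl⟩
    replace hm : m ∈ ⋃ T ∈ Q, box T := mem_iUnion₂.2 ⟨T', hT', hm⟩
    rw [linearCombination_update_zero, linearCombination_update_zero] at hlm
    -- The images differ by exactly `(m e - l e) • v e`, which is the equality case of `coeff_le`.
    have hne : ∀ i, i ≠ e → m i = l i := by
      rcases le_total (l e) (m e) with hle | hle
      · refine (h.coeff_le hl hm (sub_nonneg.2 hle) ?_).2 rfl
        rw [sub_smul, ← add_sub_assoc, add_sub_right_comm, hlm, sub_add_cancel]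
      · refine fun i hi => ((h.coeff_le hm hl (sub_nonneg.2 hle) ?_).2 rfl i hi).symm
        rw [sub_smul, ← add_sub_assoc, add_sub_right_comm, ← hlm, sub_add_cancel]
    ext i
    by_cases hie : i = e
    · subst hie; simp
    · simp [hie, hne i hie]
  surj := by
    rintro _ ⟨m, hm, rfl⟩
    obtain ⟨l, hl, hlm⟩ := h.exists_coeff_eq he hm
    obtain ⟨T, hT, hlT⟩ := mem_iUnion₂.1 hl
    refine ⟨Function.update l e 0, ?_, ?_⟩
    · simp only [biUnion_image, mem_iUnion₂]
      exact ⟨T, hT, update_mem_box_eraseLabel hlT⟩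
    · rw [linearCombination_update_zero, hlm, add_sub_cancel_right]

/-- A section does not contain two full-dimensional boxes that differ by a translation by a
coordinate vector. -/
theorem IsSection.insert_notMem (h : IsSection v S Q) {e : ι} {I B : Finset ι} (heI : e ∉ I)
    (heB : e ∉ B) (hspan : v e ∈ Submodule.span ℝ (v '' (B : Set ι))) (hT : (I, B) ∈ Q) :
    (insert e I, B) ∉ Q := by
  intro hT'
  obtain ⟨c, hc⟩ : ∃ c : ι → ℝ, ∑ i ∈ B, c i • v i = v e := by
    obtain ⟨c, hc⟩ := (Submodule.mem_span_image_finset_iff_exists_fun ℝ).1 hspan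
    refine ⟨fun i => if hi : i ∈ B then c ⟨i, hi⟩ else 0, ?_⟩
    rw [← hc, ← Finset.sum_coe_sort B]
    simp
  have hIB := fun i (h1 : i ∈ I) (h2 : i ∈ B) => Finset.disjoint_left.1 (h.disjoint _ hT) h1 h2
  -- The perturbation of the box centre by `s • c` must stay in the box. It moves the image by `s •
  -- v e`, so from `l` to `m` the image moves by only `(1 - s) • v e` while the `e`-th coefficient
  -- grows by 1, against `coeff_le`.
  obtain ⟨s, hs, hsc⟩ : ∃ s : ℝ, 0 < s ∧ s ≤ 1 ∧ ∀ i ∈ B, |s * c i| ≤ 1 / 2 := by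
    have hM : 0 ≤ ∑ i ∈ B, |c i| := Finset.sum_nonneg fun i _ => abs_nonneg _
    refine ⟨1 / (2 * (1 + ∑ i ∈ B, |c i|)), by positivity, ?_, fun i hi => ?_⟩
    · rw [div_le_one (by positivity)]; linarith
    · have : |c i| ≤ ∑ i ∈ B, |c i| :=
        Finset.single_le_sum (f := fun i => |c i|) (fun i _ => abs_nonneg _) hi
      rw [abs_mul, abs_of_pos (by positivity), div_mul_eq_mul_div, div_le_iff₀ (by positivity)]
      linarith
  let l : ι → ℝ := fun i => if i ∈ I then 1 else if i ∈ B then 1 / 2 + s * c i else 0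
  let m : ι → ℝ := fun i => if i ∈ insert e I then 1 else if i ∈ B then 1 / 2 else 0
  have hl : l ∈ box (I, B) := by
    refine ⟨fun i hi => if_pos hi, fun i hi => ?_, fun i h1 h2 => by simp_all [l]⟩
    have h1 : i ∉ I := fun h1 => hIB i h1 hi
    have h2 := abs_le.1 (hsc.2 i hi)
    simp only [l, if_neg h1, if_pos hi]
    constructor <;> linarith
  have hm : m ∈ box (insert e I, B) := by
    refine ⟨fun i hi => if_pos hi, fun i hi => ?_, fun i h1 h2 => by simp_all [m]⟩
    have h1 : i ∉ insert e I := fun h1 => by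
      rcases Finset.mem_insert.1 h1 with rfl | h1
      · exact heB hi
      · exact hIB i h1 hi
    simp only [m, if_neg h1, if_pos hi]
    norm_num
  have hlm : m - l = Pi.single e 1 - s • fun i => if i ∈ B then c i else 0 := by
    ext i
    by_cases hie : i = e
    · subst hie; simp [m, l, heI, heB]
    · by_cases h1 : i ∈ I
      · have := hIB i h1
        simp [m, l, h1, hie, show i ∉ B from this]
      · by_cases h2 : i ∈ B <;> simp [m, l, h1, h2, hie]
  have hle := (h.coeff_le (e := e) (t := 1 - s) (mem_iUnion₂.2 ⟨_, hT, hl⟩)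
    (mem_iUnion₂.2 ⟨_, hT', hm⟩) (by linarith [hsc.1]) (by
      rw [← sub_eq_iff_eq_add', ← map_sub, hlm, map_sub, map_smul, linearCombination_single,
        linearCombination_eq_sum v (B := B) (fun i hi => if_neg hi),
        Finset.sum_congr rfl (fun i hi => by rw [if_pos hi]), hc]
      module)).1
  simp [m, l, heI, heB] at hle
  linarith

/-- Remove a set of indices from a label. -/
def sdiffLabel (K : Finset ι) (T : Finset ι × Finset ι) : Finset ι × Finset ι :=
  (T.1 \ K, T.2 \ K)

theorem IsSection.sdiff (h : IsSection v Finset.univ Q) (K : Finset ι) :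
    IsSection v Kᶜ (sdiffLabel K '' Q) := by
  induction K using Finset.induction_on with
  | empty =>
    have : sdiffLabel (∅ : Finset ι) = id := by ext T : 1; simp [sdiffLabel]
    simpa [this] using h
  | insert e K he ih =>
    have h1 : (insert e K)ᶜ = Kᶜ.erase e := Finset.compl_insert
    have h2 : sdiffLabel (insert e K) = eraseLabel e ∘ sdiffLabel K := by
      ext T : 1
      simp [sdiffLabel, eraseLabel, Finset.sdiff_insert]
    rw [h1, h2, image_comp]
    exact ih.erase (by simpa using he)

/-- Indices of `K` are put back one at a time. A first disagreement at `e` would leave two boxes of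
the same section, with the same spanning `B`, differing by a translation along `e`, which
`insert_notMem` excludes. -/
theorem IsSection.eq_of_sdiff_eq (h : IsSection v Finset.univ Q) {B : Finset ι}
    (hspan : Submodule.span ℝ (v '' (B : Set ι)) = ⊤) {I I' : Finset ι} (hI : (I, B) ∈ Q)
    (hI' : (I', B) ∈ Q) {K : Finset ι} (hK : Disjoint B K) (heq : I \ K = I' \ K) : I = I' := by
  induction K using Finset.induction_on with
  | empty => simpa using heq
  | insert e K he ih =>
    rw [Finset.disjoint_insert_right] at hK
    refine ih hK.2 ?_
    have hmem : ∀ J, (J, B) ∈ Q → (J \ K, B) ∈ sdiffLabel K '' Q := fun J hJ =>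
      ⟨_, hJ, by simp [sdiffLabel, Finset.sdiff_eq_self_of_disjoint hK.2]⟩
    rw [Finset.sdiff_insert, Finset.sdiff_insert] at heq
    have aux : ∀ J J', (J, B) ∈ Q → (J', B) ∈ Q → (J \ K).erase e = (J' \ K).erase e →
        e ∈ J \ K → e ∈ J' \ K := by
      intro J J' hJ hJ' hJJ' h1
      by_contra h2
      rw [Finset.erase_eq_of_notMem h2] at hJJ'
      refine (h.sdiff K).insert_notMem h2 hK.1 (hspan ▸ Submodule.mem_top) (hmem J' hJ') ?_
      rw [← hJJ', Finset.insert_erase h1]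
      exact hmem J hJ
    by_cases h1 : e ∈ I \ K
    · rw [← Finset.insert_erase h1, heq, Finset.insert_erase (aux I I' hI hI' heq h1)]
    · have h2 : e ∉ I' \ K := fun h2 => h1 (aux I' I hI' hI heq.symm h2)
      rw [← Finset.erase_eq_of_notMem h1, heq, Finset.erase_eq_of_notMem h2]

end Section

/-! ### From fine zonotopal tilings to sections; generic points -/

section Tiling

variable {d n : ℕ} {a : Fin n → EuclideanSpace ℝ (Fin d)} {P : Set (Label n)}

theorem linearCombination_lift (a : Fin n → EuclideanSpace ℝ (Fin d)) (l : Fin n → ℝ) :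
    Fintype.linearCombination ℝ (fun i => lift (a i)) l = (∑ i, l i • a i, ∑ i, l i) := by
  rw [Fintype.linearCombination_apply]
  ext1 <;> simp [lift, Prod.fst_sum, Prod.snd_sum]

theorem linearIndepOn_lift {B : Finset (Fin n)} (hB : AffineIndependent ℝ (fun b : B => a b)) :
    LinearIndepOn ℝ (fun i => lift (a i)) (B : Set (Fin n)) := by
  rw [linearIndepOn_finset_iff]
  intro c hc i hi
  rw [affineIndependent_iff] at hB
  have h1 := congrArg Prod.fst hc
  have h2 := congrArg Prod.snd hc
  simp only [lift, Prod.fst_sum, Prod.snd_sum, Prod.smul_mk, Prod.fst_zero, Prod.snd_zero,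
    smul_eq_mul, mul_one] at h1 h2
  rw [← Finset.sum_coe_sort B] at h1 h2
  exact hB Finset.univ (fun b => c b) h2 h1 ⟨i, hi⟩ (Finset.mem_univ _)

theorem tileSet_eq_image_box {T : Label n} (hT : Disjoint T.1 T.2) :
    tileSet a T = Fintype.linearCombination ℝ (fun i => lift (a i)) '' box T := by
  have hsum : ∀ l ∈ box T, Fintype.linearCombination ℝ (fun i => lift (a i)) l =
      ∑ i ∈ T.1, lift (a i) + ∑ i ∈ T.2, l i • lift (a i) := by
    intro l hl
    rw [linearCombination_eq_sum _ (B := T.1 ∪ T.2) (fun i hi => ?_), Finset.sum_union hT]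
    · congr 1
      exact Finset.sum_congr rfl fun i hi => by rw [hl.1 i hi, one_smul]
    · rw [Finset.mem_union, not_or] at hi
      exact hl.2.2 i hi.1 hi.2
  ext p
  simp only [tileSet, singleton_add, mem_image, Set.mem_finsetSum]
  constructor
  · rintro ⟨_, ⟨g, hg, rfl⟩, rfl⟩
    have hg' : ∀ b, ∃ t : ℝ, b ∈ T.2 → t ∈ Icc (0 : ℝ) 1 ∧ t • lift (a b) = g b := by
      intro b
      by_cases hb : b ∈ T.2
      · obtain ⟨t, ht, hgt⟩ := segment_eq_image ℝ (0 : EuclideanSpace ℝ (Fin d) × ℝ) _ ▸ hg hb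
        exact ⟨t, fun _ => ⟨ht, by simpa using hgt⟩⟩
      · exact ⟨0, fun h => absurd h hb⟩
    choose t ht using hg'
    have hl : (fun i => if i ∈ T.1 then 1 else if i ∈ T.2 then t i else 0) ∈ box T := by
      refine ⟨fun i hi => if_pos hi, fun i hi => ?_, fun i h1 h2 => by simp [h1, h2]⟩
      simpa [Finset.disjoint_right.1 hT hi, hi] using (ht i hi).1
    refine ⟨_, hl, ?_⟩
    rw [hsum _ hl]
    congr 1
    refine Finset.sum_congr rfl fun i hi => ?_
    simp [Finset.disjoint_right.1 hT hi, hi, (ht i hi).2]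
  · rintro ⟨l, hl, rfl⟩
    refine ⟨_, ⟨fun i => l i • lift (a i), fun {i} hi => ?_, rfl⟩, (hsum l hl).symm⟩
    rw [segment_eq_image]
    exact ⟨l i, hl.2.1 i hi, by simp⟩

theorem zonotope_eq_image_box : zonotope a =
    Fintype.linearCombination ℝ (fun i => lift (a i)) '' box (∅, Finset.univ) := by
  rw [← tileSet_eq_image_box (T := (∅, Finset.univ)) (Finset.disjoint_empty_left _)]
  simp [tileSet, zonotope]

theorem IsFace.box_subset {F T : Label n} (h : IsFace F T) : box F ⊆ box T := by
  intro l hl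
  refine ⟨fun i hi => hl.1 i (h.2.1 hi), fun i _ => box_mem_Icc hl i, fun i h1 h2 => ?_⟩
  refine hl.2.2 i (fun hi => ?_) fun hi => h2 (h.1 hi)
  rcases Finset.mem_union.1 (h.2.2 hi) with hi | hi
  · exact h1 hi
  · exact h2 (Finset.mem_sdiff.1 hi).1

theorem IsFace.disjoint {F T : Label n} (h : IsFace F T) (hT : Disjoint T.1 T.2) :
    Disjoint F.1 F.2 := by
  refine Finset.disjoint_left.2 fun i h1 h2 => ?_
  rcases Finset.mem_union.1 (h.2.2 h1) with hi | hi
  · exact Finset.disjoint_left.1 hT hi (h.1 h2)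
  · exact (Finset.mem_sdiff.1 hi).2 h2

/-- A point common to two tiles lies in a common face, whose box is contained in both boxes. As `L`
is injective on each box, the two lifts both equal the lift in the face. -/
theorem IsFineZonotopalTiling.isSection (hP : IsFineZonotopalTiling a P) :
    IsSection (fun i => lift (a i)) Finset.univ P where
  disjoint T hT := (hP.isTileLabel T hT).disjoint
  indep T hT := linearIndepOn_lift (hP.isTileLabel T hT).affineIndependent
  fst_subset _ _ := Finset.subset_univ _
  snd_subset _ _ := Finset.subset_univ _
  surj := by
    rw [← zonotope_eq_image_box, ← hP.iUnion_eq, image_iUnion₂]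
    exact iUnion₂_mono fun T hT => (tileSet_eq_image_box (hP.isTileLabel T hT).disjoint).subset
  inj := by
    intro l hl m hm hlm
    obtain ⟨T, hT, hl⟩ := mem_iUnion₂.1 hl
    obtain ⟨T', hT', hm⟩ := mem_iUnion₂.1 hm
    have hd := (hP.isTileLabel T hT).disjoint
    have hd' := (hP.isTileLabel T' hT').disjoint
    have hmem : Fintype.linearCombination ℝ (fun i => lift (a i)) l ∈
        tileSet a T ∩ tileSet a T' := by
      rw [tileSet_eq_image_box hd, tileSet_eq_image_box hd']
      exact ⟨⟨l, hl, rfl⟩, ⟨m, hm, hlm.symm⟩⟩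
    obtain ⟨F, hF, hF', hFeq⟩ := hP.inter_face T hT T' hT' ⟨_, hmem⟩
    rw [hFeq, tileSet_eq_image_box (hF.disjoint hd)] at hmem
    obtain ⟨f, hf, hfl⟩ := hmem
    rw [← injOn_box (linearIndepOn_lift (hP.isTileLabel T hT).affineIndependent)
        (hF.box_subset hf) hl hfl,
      ← injOn_box (linearIndepOn_lift (hP.isTileLabel T' hT').affineIndependent)
        (hF'.box_subset hf) hm (hfl.trans hlm)]

theorem span_lift_eq_top {T : Label n} (hT : IsTileLabel a T) :
    Submodule.span ℝ ((fun i => lift (a i)) '' (T.2 : Set (Fin n))) = ⊤ := by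
  have h := linearIndepOn_lift hT.affineIndependent
  rw [image_eq_range]
  refine LinearIndependent.span_eq_top_of_card_eq_finrank' h ?_
  simp [hT.card_eq]

/-- A point is generic when it lies in the convex hull of no `d` points of the configuration. -/
def IsGeneric (a : Fin n → EuclideanSpace ℝ (Fin d)) (x : EuclideanSpace ℝ (Fin d)) : Prop :=
  ∀ C : Finset (Fin n), C.card ≤ d → x ∉ convexHull ℝ (a '' (C : Set (Fin n)))

theorem mem_convexHull_image_iff {C : Finset (Fin n)} {x : EuclideanSpace ℝ (Fin d)} :
    x ∈ convexHull ℝ (a '' (C : Set (Fin n))) ↔ ∃ c : Fin n → ℝ, (∀ i, 0 ≤ c i) ∧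
      (∀ i ∉ C, c i = 0) ∧ ∑ i, c i = 1 ∧ ∑ i, c i • a i = x := by
  constructor
  · intro hx
    have hs : Convex ℝ {x | ∃ c : Fin n → ℝ, (∀ i, 0 ≤ c i) ∧
        (∀ i ∉ C, c i = 0) ∧ ∑ i, c i = 1 ∧ ∑ i, c i • a i = x} := by
      rintro _ ⟨c, hc0, hcC, hc1, rfl⟩ _ ⟨c', hc0', hcC', hc1', rfl⟩ p q hp hq hpq
      refine ⟨p • c + q • c', fun i => ?_, fun i hi => by simp [hcC i hi, hcC' i hi], ?_, ?_⟩
      · exact add_nonneg (mul_nonneg hp (hc0 i)) (mul_nonneg hq (hc0' i))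
      · simp [Finset.sum_add_distrib, ← Finset.mul_sum, hc1, hc1', hpq]
      · simp [Finset.sum_add_distrib, Finset.smul_sum, add_smul, mul_smul]
    refine convexHull_min ?_ hs hx
    rintro _ ⟨j, hj, rfl⟩
    refine ⟨Pi.single j 1, fun i => ?_, fun i hi => ?_, by simp, by simp [Pi.single_apply]⟩
    · by_cases hij : i = j
      · subst hij; simp
      · simp [hij]
    · have hij : i ≠ j := fun hij => hi (hij ▸ hj)
      simp [hij]
  · rintro ⟨c, hc0, hcC, hc1, rfl⟩
    rw [← Finset.sum_subset (Finset.subset_univ C) (fun i _ hi => by simp [hcC i hi])]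
    rw [← Finset.sum_subset (Finset.subset_univ C) (fun i _ hi => hcC i hi)] at hc1
    exact (convex_convexHull ℝ _).sum_mem (fun i _ => hc0 i) hc1
      fun i hi => subset_convexHull ℝ _ (mem_image_of_mem a hi)

/-- A vanishing barycentric coordinate would put `x` in the hull of only `d` of the points. -/
theorem IsGeneric.support_eq {x : EuclideanSpace ℝ (Fin d)} (hx : IsGeneric a x)
    {B : Finset (Fin n)} (hB : B.card = d + 1) {c : Fin n → ℝ} (hc0 : ∀ i, 0 ≤ c i)
    (hcB : ∀ i ∉ B, c i = 0) (hc1 : ∑ i, c i = 1) (hcx : ∑ i, c i • a i = x) (i : Fin n) :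
    i ∈ B ↔ c i ≠ 0 := by
  refine ⟨fun hi h0 => ?_, fun hi => by_contra fun hiB => hi (hcB i hiB)⟩
  refine hx (B.erase i) (by rw [Finset.card_erase_of_mem hi, hB]; rfl)
    (mem_convexHull_image_iff.2 ⟨c, hc0, fun j hj => ?_, hc1, hcx⟩)
  by_cases hji : j = i
  · rw [hji, h0]
  · exact hcB j fun hjB => hj (Finset.mem_erase.2 ⟨hji, hjB⟩)

/-- For each set `K` of indices, a generic point of the convex hull of the `a_i`, `i ∉ K`, lies in
the simplex of exactly one tile `(I, B)` with `I ⊆ K` and `B ∩ K = ∅`. -/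
theorem IsFineZonotopalTiling.existsUnique_tile (hP : IsFineZonotopalTiling a P)
    {x : EuclideanSpace ℝ (Fin d)} (hx : IsGeneric a x) {K : Finset (Fin n)}
    (hxK : x ∈ convexHull ℝ (a '' ((Kᶜ : Finset (Fin n)) : Set (Fin n)))) :
    ∃! T, T ∈ P ∧ x ∈ simplex a T ∧ T.1 ⊆ K ∧ Disjoint T.2 K := by
  have hsec := hP.isSection.sdiff K
  refine existsUnique_of_exists_of_unique ?_ ?_
  · obtain ⟨c, hc0, hcK, hc1, hcx⟩ := mem_convexHull_image_iff.1 hxK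
    have hcle : ∀ i, c i ≤ 1 := fun i =>
      hc1 ▸ Finset.single_le_sum (fun j _ => hc0 j) (Finset.mem_univ i)
    -- Any height strictly between 0 and 1 would do: the coefficient sum stays below 1, which
    -- excludes a coefficient equal to 1.
    have hbox : (1 / 2 : ℝ) • c ∈ box (∅, Kᶜ) := by
      refine ⟨by simp, fun i _ => ?_, fun i _ hi => by simp [hcK i hi]⟩
      have h0 := hc0 i
      have h1 := hcle i
      constructor <;> simp <;> linarith
    obtain ⟨l, hl, hlc⟩ := hsec.surj ⟨_, hbox, rfl⟩
    simp only [biUnion_image, mem_iUnion₂] at hl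
    obtain ⟨T, hT, hl⟩ := hl
    rw [linearCombination_lift, linearCombination_lift, Prod.mk.injEq] at hlc
    simp only [Pi.smul_apply, smul_eq_mul, ← Finset.mul_sum, hc1, mul_smul, ← Finset.smul_sum,
      hcx] at hlc
    have hI : T.1 ⊆ K := by
      intro i hi
      by_contra hiK
      have h1 : l i = 1 := hl.1 i (Finset.mem_sdiff.2 ⟨hi, hiK⟩)
      have h2 := Finset.single_le_sum (fun j _ => (box_mem_Icc hl j).1) (Finset.mem_univ i)
      rw [h1, hlc.2] at h2
      norm_num at h2
    have hxB : x ∈ convexHull ℝ (a '' ((T.2 \ K : Finset (Fin n)) : Set (Fin n))) := by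
      refine mem_convexHull_image_iff.2 ⟨(2 : ℝ) • l, fun i => ?_, fun i hi => ?_, ?_, ?_⟩
      · exact mul_nonneg zero_le_two (box_mem_Icc hl i).1
      · have h0 : l i = 0 := hl.2.2 i (fun h => by
          simp [sdiffLabel, Finset.sdiff_eq_empty_iff_subset.2 hI] at h) hi
        simp [h0]
      · simp [← Finset.mul_sum, hlc.2]
      · simp only [Pi.smul_apply, smul_eq_mul, mul_smul, ← Finset.smul_sum, hlc.1]
        rw [smul_smul]
        norm_num
    -- If `B` met `K`, then `B \ K` would have at most `d` elements.
    have hBK : Disjoint T.2 K := by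
      by_contra hnd
      refine hx (T.2 \ K) (Nat.lt_succ_iff.1 ?_) hxB
      rw [Nat.succ_eq_add_one, ← (hP.isTileLabel T hT).card_eq]
      exact Finset.card_lt_card (Finset.sdiff_subset.ssubset_of_ne fun h => hnd (Finset.sdiff_eq_self_iff_disjoint.1 h))
    refine ⟨T, hT, ?_, hI, hBK⟩
    rwa [Finset.sdiff_eq_self_of_disjoint hBK] at hxB
  -- Both tiles lift the same point of height 1/2, so their coefficient vectors agree. Its support
  -- recovers `B`, and then `I` is recovered from `I \ K = ∅`.
  · have key : ∀ T ∈ P, x ∈ simplex a T → T.1 ⊆ K → Disjoint T.2 K → ∃ c : Fin n → ℝ,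
        (∀ i, i ∈ T.2 ↔ c i ≠ 0) ∧ (1 / 2 : ℝ) • c ∈ box (sdiffLabel K T) ∧
        Fintype.linearCombination ℝ (fun i => lift (a i)) c = (x, 1) := by
      intro T hT hxT hI hB
      obtain ⟨c, hc0, hcK, hc1, hcx⟩ := mem_convexHull_image_iff.1 hxT
      have hcle : ∀ i, c i ≤ 1 := fun i =>
        hc1 ▸ Finset.single_le_sum (fun j _ => hc0 j) (Finset.mem_univ i)
      refine ⟨c, hx.support_eq (hP.isTileLabel T hT).card_eq hc0 hcK hc1 hcx, ?_, ?_⟩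
      · rw [sdiffLabel, Finset.sdiff_eq_empty_iff_subset.2 hI, Finset.sdiff_eq_self_of_disjoint hB]
        refine ⟨by simp, fun i _ => ?_, fun i _ hi => by simp [hcK i hi]⟩
        have h0 := hc0 i
        have h1 := hcle i
        constructor <;> simp <;> linarith
      · rw [linearCombination_lift, hcx, hc1]
    rintro T T' ⟨hT, hxT, hI, hB⟩ ⟨hT', hxT', hI', hB'⟩
    obtain ⟨c, hcB, hc, hcL⟩ := key T hT hxT hI hB
    obtain ⟨c', hcB', hc', hcL'⟩ := key T' hT' hxT' hI' hB'
    have heq := hsec.inj (mem_iUnion₂.2 ⟨_, ⟨T, hT, rfl⟩, hc⟩)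
      (mem_iUnion₂.2 ⟨_, ⟨T', hT', rfl⟩, hc'⟩) (by rw [map_smul, map_smul, hcL, hcL'])
    obtain rfl : c = c' := smul_right_injective _ (by norm_num : (1 / 2 : ℝ) ≠ 0) heq
    obtain ⟨I, B⟩ := T
    obtain ⟨I', B'⟩ := T'
    obtain rfl : B = B' := by
      ext i
      exact (hcB i).trans (hcB' i).symm
    rw [hP.isSection.eq_of_sdiff_eq (span_lift_eq_top (hP.isTileLabel _ hT)) hT hT' hB]
    exact (Finset.sdiff_eq_empty_iff_subset.2 hI).trans
      (Finset.sdiff_eq_empty_iff_subset.2 hI').symm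

end Tiling

/-! ### Binomial identities and the triangular system -/

section Counting

/-- This compares coefficients of `X^j` in `(1-X)^{-(d+1)} (1-X)^{-(m-j+1)} = (1-X)^{-(d+m-j+2)}`;
the second exponent depends on `j`. -/
theorem sum_choose_mul_choose (d m j : ℕ) (hj : j ≤ m) :
    ∑ i ∈ Finset.range (j + 1), (i + d).choose d * (m - i).choose (j - i) =
      (m + d + 1).choose j := by
  have h := congrArg (fun f => PowerSeries.coeff j (Units.val f))
    (PowerSeries.invOneSubPow_add ℤ (d + 1) (m - j + 1))
  have hadd : d + 1 + (m - j + 1) = (d + 1 + (m - j)) + 1 := by ring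
  simp only [hadd, Units.val_mul, PowerSeries.coeff_mul,
    PowerSeries.invOneSubPow_val_succ_eq_mk_add_choose, PowerSeries.coeff_mk,
    Finset.Nat.sum_antidiagonal_eq_sum_range_succ_mk] at h
  have h' : (d + 1 + (m - j) + j).choose (d + 1 + (m - j)) =
      ∑ i ∈ Finset.range (j + 1), (d + i).choose d * (m - j + (j - i)).choose (m - j) := by
    exact_mod_cast h
  rw [show d + 1 + (m - j) + j = m + d + 1 by omega,
    Nat.choose_symm_of_eq_add (show m + d + 1 = d + 1 + (m - j) + j by omega)] at h'
  rw [h']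
  refine Finset.sum_congr rfl fun i hi => ?_
  have hi' : i ≤ j := Nat.lt_succ_iff.1 (Finset.mem_range.1 hi)
  rw [add_comm i d, show m - j + (j - i) = m - i by omega,
    Nat.choose_symm_of_eq_add (show m - i = m - j + (j - i) by omega)]

/-- Such `K` correspond to `K \ I`, a subset of the complement of `I ∪ B`. The case split matters:
for `j < I.card` the truncated subtraction would give the binomial coefficient 1 instead of 0. -/
theorem card_between {α : Type*} [Fintype α] [DecidableEq α] {I B : Finset α}
    (hIB : Disjoint I B) (j : ℕ) :
    ((Finset.univ.powersetCard j).filter fun K => I ⊆ K ∧ Disjoint B K).card =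
      if I.card ≤ j then (Fintype.card α - B.card - I.card).choose (j - I.card) else 0 := by
  split_ifs with hj
  · have hcard : Fintype.card α - B.card - I.card = ((I ∪ B)ᶜ).card := by
      rw [Finset.card_compl, Finset.card_union_of_disjoint hIB]; omega
    rw [hcard, ← Finset.card_powersetCard]
    refine Finset.card_bij' (fun K _ => K \ I) (fun K _ => K ∪ I) ?_ ?_ ?_ ?_
    · intro K hK
      simp only [Finset.mem_filter, Finset.mem_powersetCard, Finset.subset_univ, true_and] at hK ⊢
      refine ⟨fun i hi => ?_, ?_⟩
      · rw [Finset.mem_sdiff] at hi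
        simp only [Finset.mem_compl, Finset.mem_union, not_or]
        exact ⟨hi.2, fun hB => Finset.disjoint_left.1 hK.2.2 hB hi.1⟩
      · rw [Finset.card_sdiff_of_subset hK.2.1, hK.1]
    · intro K hK
      simp only [Finset.mem_filter, Finset.mem_powersetCard, Finset.subset_univ, true_and] at hK ⊢
      have hKd : ∀ i ∈ K, i ∉ I ∧ i ∉ B := fun i hi => by simpa using hK.1 hi
      refine ⟨?_, Finset.subset_union_right, ?_⟩
      · rw [Finset.card_union_of_disjoint (Finset.disjoint_left.2 fun i hi => (hKd i hi).1), hK.2]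
        omega
      · exact Finset.disjoint_union_right.2
          ⟨Finset.disjoint_right.2 fun i hi => (hKd i hi).2, hIB.symm⟩
    · intro K hK
      simp only [Finset.mem_filter] at hK
      exact Finset.sdiff_union_of_subset hK.2.1
    · intro K hK
      have hKd : ∀ i ∈ K, i ∉ I ∧ i ∉ B := fun i hi => by
        simpa using (Finset.mem_powersetCard.1 hK).1 hi
      exact Finset.union_sdiff_cancel_right (Finset.disjoint_left.2 fun i hi => (hKd i hi).1)
  · rw [Finset.card_eq_zero, Finset.filter_eq_empty_iff]
    intro K hK h
    exact hj ((Finset.mem_powersetCard.1 hK).2 ▸ Finset.card_le_card h.1)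

/-- The values `(i + d).choose d` are determined by a triangular system of equations. -/
theorem eq_choose_of_sum_eq {d m k : ℕ} (hk : k ≤ m) (N : ℕ → ℕ)
    (h : ∀ j ≤ k, ∑ i ∈ Finset.range (j + 1), N i * (m - i).choose (j - i) =
      (m + d + 1).choose j) : ∀ j ≤ k, N j = (j + d).choose d := by
  intro j
  induction j using Nat.strong_induction_on with
  | _ j ih =>
    intro hj
    have h1 := h j hj
    have h2 := sum_choose_mul_choose d m j (hj.trans hk)
    rw [Finset.sum_range_succ] at h1 h2
    rw [Finset.sum_congr rfl fun i hi => by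
      rw [ih i (Finset.mem_range.1 hi) ((Finset.mem_range.1 hi).le.trans hj)]] at h1
    simp only [Nat.sub_self, Nat.choose_zero_right, mul_one] at h1 h2
    omega

end Counting

/-! ### Double counting at generic points of `ch_k(A)` -/

section Cover

variable {d n : ℕ} {a : Fin n → EuclideanSpace ℝ (Fin d)} {P : Set (Label n)}

theorem mem_convexHull_compl_of_mem_chk {k : ℕ} {x : EuclideanSpace ℝ (Fin d)}
    (hx : x ∈ chk a k) (hk : k ≤ n) {K : Finset (Fin n)} (hK : K.card ≤ k) :
    x ∈ convexHull ℝ (a '' ((Kᶜ : Finset (Fin n)) : Set (Fin n))) := by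
  obtain ⟨K', hKK', hK'⟩ := Finset.exists_superset_card_eq hK (by simpa using hk)
  refine convexHull_mono (image_mono ?_) (mem_iInter₂.1 hx K'ᶜ ?_)
  · exact Finset.coe_subset.2 (Finset.compl_subset_compl.2 hKK')
  · rw [Finset.card_compl, Fintype.card_fin, hK']

theorem IsFineZonotopalTiling.coverCount_eq (hP : IsFineZonotopalTiling a P) {k : ℕ}
    (hk : k + d + 1 ≤ n) {x : EuclideanSpace ℝ (Fin d)} (hx : IsGeneric a x)
    (hxk : x ∈ chk a k) : coverCount a P k x = (k + d).choose d := by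
  classical
  set X : Finset (Label n) := Finset.univ.filter fun T => T ∈ P ∧ x ∈ simplex a T with hX
  have hcover : ∀ i, coverCount a P i x = (X.filter fun T => T.1.card = i).card := by
    intro i
    rw [coverCount, ← ncard_coe_finset]
    congr 1
    ext T
    simp [hX, orderTiles]
    tauto
  rw [hcover]
  refine eq_choose_of_sum_eq (m := n - d - 1) (by omega)
    (fun i => (X.filter fun T => T.1.card = i).card) (fun j hj => ?_) k le_rfl
  have hone : ∀ K ∈ (Finset.univ : Finset (Fin n)).powersetCard j,
      (X.filter fun T => T.1 ⊆ K ∧ Disjoint T.2 K).card = 1 := by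
    intro K hK
    have hKj := (Finset.mem_powersetCard.1 hK).2
    obtain ⟨T, hT, huniq⟩ := hP.existsUnique_tile hx
      (mem_convexHull_compl_of_mem_chk hxk (by omega) (hKj.le.trans hj))
    rw [Finset.card_eq_one]
    refine ⟨T, Finset.ext fun T' => ?_⟩
    simp only [hX, Finset.mem_filter, Finset.mem_univ, true_and, Finset.mem_singleton]
    constructor
    · exact fun h => huniq T' ⟨h.1.1, h.1.2, h.2⟩
    · rintro rfl
      exact ⟨⟨hT.1, hT.2.1⟩, hT.2.2⟩
  -- The pairs `(K, T)` with `I ⊆ K` and `B ∩ K = ∅` are counted by `K`, one tile each, and then by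
  -- `T`. The left side is `C(n,j)`, written with `m = n - d - 1`.
  have htotal : (n - d - 1 + d + 1).choose j = ∑ T ∈ X,
      if T.1.card ≤ j then (n - d - 1 - T.1.card).choose (j - T.1.card) else 0 := by
    have h1 : (n - d - 1 + d + 1).choose j = ∑ K ∈ (Finset.univ : Finset (Fin n)).powersetCard j,
        (X.filter fun T => T.1 ⊆ K ∧ Disjoint T.2 K).card := by
      rw [Finset.sum_congr rfl hone, Finset.sum_const, Finset.card_powersetCard, Finset.card_univ,
        Fintype.card_fin, smul_eq_mul, mul_one]
      congr 1
      omega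
    rw [h1]
    refine (Finset.sum_card_bipartiteAbove_eq_sum_card_bipartiteBelow
      (fun (K : Finset (Fin n)) (T : Label n) => T.1 ⊆ K ∧ Disjoint T.2 K)).trans ?_
    refine Finset.sum_congr rfl fun T hT => ?_
    have hlab := hP.isTileLabel T (Finset.mem_filter.1 hT).2.1
    rw [Finset.bipartiteBelow, card_between hlab.disjoint, Fintype.card_fin, hlab.card_eq,
      Nat.sub_sub n d 1]
  rw [htotal, ← Finset.sum_filter, ← Finset.sum_fiberwise_of_maps_to
    (g := fun T : Label n => T.1.card) (t := Finset.range (j + 1))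
    (fun T hT => Finset.mem_range.2 (Nat.lt_succ_iff.2 (Finset.mem_filter.1 hT).2))]
  refine Finset.sum_congr rfl fun i hi => ?_
  have hij : i ≤ j := Nat.lt_succ_iff.1 (Finset.mem_range.1 hi)
  rw [Finset.sum_congr rfl (g := fun _ => (n - d - 1 - i).choose (j - i))
    (fun T hT => by rw [(Finset.mem_filter.1 hT).2]), Finset.sum_const, Finset.filter_filter, smul_eq_mul]
  congr 2
  ext T
  simp only [hX, Finset.mem_filter, Finset.mem_univ, true_and]
  constructor
  · rintro ⟨h, rfl⟩
    exact ⟨⟨h, hij⟩, rfl⟩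
  · exact fun h => ⟨h.1.1, h.2⟩

/-- At most `d` points span a proper affine subspace, which is null, and there are finitely many
such subsets. -/
theorem ae_isGeneric (a : Fin n → EuclideanSpace ℝ (Fin d)) :
    ∀ᵐ x ∂(MeasureTheory.volume : MeasureTheory.Measure (EuclideanSpace ℝ (Fin d))),
      IsGeneric a x := by
  simp only [IsGeneric, MeasureTheory.ae_all_iff]
  intro C
  by_cases hC : C.card ≤ d
  swap
  · simp [hC]
  simp only [hC, forall_const]
  have hne : affineSpan ℝ (a '' (C : Set (Fin n))) ≠ ⊤ := by
    intro htop
    rcases hc : C.card with _ | c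
    · rw [Finset.card_eq_zero.1 hc, Finset.coe_empty, image_empty, AffineSubspace.span_empty] at htop
      exact AffineSubspace.bot_ne_top ℝ _ _ htop
    · have h1 := finrank_vectorSpan_image_finset_le ℝ a C hc
      rw [Finset.coe_image, ← direction_affineSpan, htop, AffineSubspace.direction_top,
        finrank_top, finrank_euclideanSpace_fin] at h1
      omega
  refine MeasureTheory.measure_mono_null (fun x hx => ?_)
    (MeasureTheory.Measure.addHaar_affineSubspace MeasureTheory.volume _ hne)
  exact convexHull_subset_affineSpan _ (not_not.1 hx)

end Cover

end ZonoTiling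
end

/-! ### Passage from generic to arbitrary points -/

theorem proposition4 {d n : ℕ} (a : Fin n → EuclideanSpace ℝ (Fin d))
    (ha : affineSpan ℝ (Set.range a) = ⊤)
    (P : Set (ZonoTiling.Label n)) (hP : ZonoTiling.IsFineZonotopalTiling a P)
    (k : ℕ) (hk : k + d + 1 ≤ n) :
    (∀ᵐ x ∂(MeasureTheory.volume : MeasureTheory.Measure (EuclideanSpace ℝ (Fin d))),
      x ∈ ZonoTiling.chk a k → ZonoTiling.coverCount a P k x = (k + d).choose d) ∧
    ((interior (ZonoTiling.chk a k)).Nonempty → ∀ x ∈ ZonoTiling.chk a k,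
      ZonoTiling.interiorCoverCount a P k x ≤ (k + d).choose d ∧
      (k + d).choose d ≤ ZonoTiling.coverCount a P k x ∧
      ((∀ T ∈ ZonoTiling.orderTiles P k, x ∉ frontier (ZonoTiling.simplex a T)) →
        ZonoTiling.coverCount a P k x = (k + d).choose d)) := by
  classical
  have hae := ZonoTiling.ae_isGeneric a
  refine ⟨hae.mono fun x hx hxk => hP.coverCount_eq hk hx hxk, fun hint x hx => ?_⟩
  have hclosed : ∀ T : ZonoTiling.Label n, IsClosed (ZonoTiling.simplex a T) := fun T =>
    ((Set.toFinite _).isCompact_convexHull ℝ).isClosed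
  have hconv : Convex ℝ (ZonoTiling.chk a k) :=
    convex_iInter₂ fun _ _ => convex_convexHull ℝ _
  have hxcl : x ∈ closure (interior (ZonoTiling.chk a k)) := by
    rw [hconv.closure_interior_eq_closure_of_nonempty_interior hint]
    exact subset_closure hx
  -- Near `x`, every simplex containing `y` contains `x`, and every simplex with `x` in its interior
  -- contains `y`. So the count at a generic `y` lies between the interior and closed counts at `x`.
  obtain ⟨U, hU, hxU, hUT⟩ : ∃ U : Set (EuclideanSpace ℝ (Fin d)), IsOpen U ∧ x ∈ U ∧
      ∀ y ∈ U, ∀ T : ZonoTiling.Label n, (y ∈ ZonoTiling.simplex a T → x ∈ ZonoTiling.simplex a T) ∧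
        (x ∈ interior (ZonoTiling.simplex a T) → y ∈ ZonoTiling.simplex a T) := by
    have hev : ∀ᶠ y in nhds x, ∀ T : ZonoTiling.Label n,
        (y ∈ ZonoTiling.simplex a T → x ∈ ZonoTiling.simplex a T) ∧
        (x ∈ interior (ZonoTiling.simplex a T) → y ∈ ZonoTiling.simplex a T) := by
      refine Filter.eventually_all.2 fun T => Filter.Eventually.and ?_ ?_
      · by_cases hxT : x ∈ ZonoTiling.simplex a T
        · simp [hxT]
        · filter_upwards [(hclosed T).isOpen_compl.mem_nhds hxT] with y hy h
          exact absurd h hy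
      · by_cases hxT : x ∈ interior (ZonoTiling.simplex a T)
        · filter_upwards [isOpen_interior.mem_nhds hxT] with y hy _
          exact interior_subset hy
        · simp [hxT]
    obtain ⟨U, hUT, hU, hxU⟩ := eventually_nhds_iff.1 hev
    exact ⟨U, hU, hxU, hUT⟩
  -- Nonempty interior makes the convex set `ch_k(A)` lie in the closure of its interior, so `U`
  -- meets this interior in a nonempty open set, and generic points are dense.
  obtain ⟨y, ⟨hyU, hyk⟩, hy⟩ := (MeasureTheory.Measure.dense_of_ae hae).inter_open_nonempty
    (U ∩ interior (ZonoTiling.chk a k)) (hU.inter isOpen_interior)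
    (mem_closure_iff.1 hxcl U hU hxU)
  have hcount := hP.coverCount_eq hk hy (interior_subset hyk)
  have hle : (k + d).choose d ≤ ZonoTiling.coverCount a P k x := by
    rw [← hcount]
    exact Set.ncard_le_ncard (fun T hT => ⟨hT.1, (hUT y hyU T).1 hT.2⟩) (Set.toFinite _)
  have hge : ZonoTiling.interiorCoverCount a P k x ≤ (k + d).choose d := by
    rw [← hcount]
    exact Set.ncard_le_ncard (fun T hT => ⟨hT.1, (hUT y hyU T).2 hT.2⟩) (Set.toFinite _)
  refine ⟨hge, hle, fun hfr => le_antisymm (le_trans ?_ hge) hle⟩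
  refine Set.ncard_le_ncard (fun T hT => ⟨hT.1, ?_⟩) (Set.toFinite _)
  by_contra hni
  exact hfr T hT.1 ⟨subset_closure hT.2, hni⟩
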